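/- **Conventions.** Strings are finite binary strings. $U$ is a universal prefix machine (with side input), $K_U(x\mid y)$ is the length of a shortest $U$-program for $x$ given $y$, $K_U(x)=K_U(x\mid\varepsilon)$ with $\varepsilon$ the empty string, and $$I_{\mathrm{alg}}(x:y):=K_U(y)-K_U(y\mid x)$$ is the algorithmic information that $x$ carries about $y$. An adaptation process is a computable device acting on a control state, the content of the execution substrate, the content of an input register, and the bit cells of the adaptation substrate $\mathcal H_{\mathrm{adapt}}$. Each of its steps is either logically reversible, i.e. a deterministic move to a configuration that has no other predecessor, or a logical erasure, i.e. an irreversible overwriting of one cell of $\mathcal H_{\mathrm{adapt}}$ by a bit (not necessarily determined by the past) which loses only the old content of that cell. The process starts in a fixed control state with initial execution-substrate state $S_0$, adaptation input $\mathcal D$ and blank adaptation substrate; it halts with execution-substrate state $S$ after $H_{\mathrm{erase}}$ logical erasures. For a task class $\mathcal C$ with descriptor $\sigma(\mathcal C)$ (any string), put $\mu:=I_{\mathrm{alg}}(S:\sigma(\mathcal C))$. Let $c=k_BT\ln 2$ with temperature $T>0$, let $F(\mathcal H_{\mathrm{adapt}})\ge 1$ be the overhead factor of the adaptation substrate, and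 let the adaptation energy obey the Landauer floor $E_{\mathrm{adapt}}\ge F(\mathcal H_{\mathrm{adapt}})\,H_{\mathrm{erase}}\,c$. **Theorem (Thermodynamic cost of structural information).** For every universal prefix machine $U$ and every $b\in\mathbb N$ there is a constant $c_U\in\mathbb N$, depending only on $U$ and $b$, such that the following holds. For every adaptation process with description of complexity at most $b$, every descriptor $\sigma(\mathcal C)$, every initial state $S_0$ with no information about it, in the sense that $K_U(\sigma(\mathcal C))\le K_U(\sigma(\mathcal C)\mid S_0)+b$, every adaptation input $\mathcal D$, and every halting run of the process from $(S_0,\mathcal D)$ to a final execution-substrate state $S$, $$E_{\mathrm{adapt}}\;\ge\;F(\mathcal H_{\mathrm{adapt}})\,c\,\bigl[\mu-I_{\mathrm{alg}}(\mathcal D:\sigma(\mathcal C))-c_U\bigr]_+ ,\qquad [x]_+:=\max(x,0).$$ -/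

import Mathlib

/-! ## Prefix Kolmogorov complexity -/

/-- A (conditional) prefix machine: a partial recursive function of a program `p` and a side
input `y` whose domain is prefix-free in `p` for every fixed `y`. -/
structure PrefixMachine where
  eval : List Bool → List Bool →. List Bool
  partrec : Partrec₂ eval
  prefix_free : ∀ y p q : List Bool,
    (eval p y).Dom → (eval q y).Dom → p <+: q → p = q

namespace PrefixMachine

/-- `U` is universal: it simulates every prefix machine `V` with programs that are longer by at
most an additive constant depending only on `V` (this holds in particular when
`U (w ++ p) y = V p y` for a fixed compiler prefix `w`). -/
def IsUniversal (U : PrefixMachine) : Prop :=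
  ∀ V : PrefixMachine, ∃ d : ℕ, ∀ p y x : List Bool,
    x ∈ V.eval p y → ∃ q : List Bool, q.length ≤ p.length + d ∧ x ∈ U.eval q y

/-- Conditional prefix complexity `K_U(x | y)`: the length of a shortest program for `x` given
`y`. For a universal `U` the set of lengths is never empty. -/
noncomputable def condK (U : PrefixMachine) (x y : List Bool) : ℕ :=
  sInf {n : ℕ | ∃ p : List Bool, p.length = n ∧ x ∈ U.eval p y}

/-- Prefix complexity `K_U(x)`: there is no side input. -/
noncomputable def K (U : PrefixMachine) (x : List Bool) : ℕ :=
  U.condK x []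

/-- Algorithmic mutual information `I_alg(x : y) = K_U(y) - K_U(y | x)`, the information that `x`
carries about `y`. -/
noncomputable def mutualInfo (U : PrefixMachine) (x y : List Bool) : ℝ :=
  (U.K y : ℝ) - (U.condK y x : ℝ)

end PrefixMachine

/-! ## Adaptation processes and logical erasures -/

/-- A configuration `(control, exec, input, work)` of an adaptation device: the control state, the
contents of the execution substrate, of the register holding the adaptation input, and of the
bit cells of the adaptation substrate. -/
abbrev AdaptConfig : Type := ℕ × List Bool × List Bool × List Bool

/-- What the device does in a configuration: `none` is halting, `some (Sum.inl q)` is a logically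
reversible move to `q`, and `some (Sum.inr (i, l))` is a logical erasure of cell `i` of the
adaptation substrate, after which the control state is `l`. -/
abbrev AdaptInstr : Type := Option (AdaptConfig ⊕ (ℕ × ℕ))

/-- `AdaptStep instr q n r`: the device can go from `q` to `r` in one step that performs `n` logical
erasures. An erasure destroys the old content of one cell of the adaptation substrate and leaves
a bit `v` there, which the earlier configuration need not determine: `v = false` is a reset, and
in general this is an irreversible write. All other steps are determined by the configuration, so
irreversible writes are the only way in which information that is not
computable from the initial configuration can enter. -/
inductive AdaptStep (instr : AdaptConfig → AdaptInstr) : AdaptConfig → ℕ → AdaptConfig → Prop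
  | reversible (q r : AdaptConfig) (h : instr q = some (Sum.inl r)) : AdaptStep instr q 0 r
  | erase (k l i : ℕ) (S D W : List Bool) (v : Bool)
      (h : instr (k, S, D, W) = some (Sum.inr (i, l))) (hi : i < W.length) :
      AdaptStep instr (k, S, D, W) 1 (l, S, D, W.set i v)

/-- `AdaptRun instr q n r`: the device can go from `q` to `r` in finitely many steps that perform
`n` logical erasures altogether. -/
inductive AdaptRun (instr : AdaptConfig → AdaptInstr) : AdaptConfig → ℕ → AdaptConfig → Prop
  | refl (q : AdaptConfig) : AdaptRun instr q 0 q
  | step (q r s : AdaptConfig) (m n : ℕ) (h₁ : AdaptRun instr q m r)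
      (h₂ : AdaptStep instr r n s) : AdaptRun instr q (m + n) s

/-- An adaptation process: an effectively given device each of whose steps is either logically
reversible or erases exactly one bit. -/
structure AdaptationProcess where
  /-- The program of the device. -/
  code : Nat.Partrec.Code
  /-- The instruction carried out in each configuration. -/
  instr : AdaptConfig → AdaptInstr
  computes : ∀ q : AdaptConfig,
    code.eval (Encodable.encode q) = Part.some (Encodable.encode (instr q))
  /-- A configuration reached by a reversible move has no other predecessor. -/
  reversible_inj : ∀ (q r q' : AdaptConfig) (n : ℕ),
    instr q = some (Sum.inl r) → AdaptStep instr q' n r → q' = q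
  /-- Two predecessors of a configuration reached by erasures have the same control state and the
  same erased cell, hence differ at most in the bit that the erasure destroyed. -/
  erase_one_bit : ∀ (q q' r : AdaptConfig) (i j l l' : ℕ),
    instr q = some (Sum.inr (i, l)) → instr q' = some (Sum.inr (j, l')) →
    AdaptStep instr q 1 r → AdaptStep instr q' 1 r → q.1 = q'.1 ∧ i = j

namespace AdaptationProcess

/-- The description of the process as a binary string. -/
def description (P : AdaptationProcess) : List Bool :=
  Nat.bits (Encodable.encode P.code)

/-- `P.Adapts S₀ D S H`: started in control state `0` with execution substrate `S₀`, adaptation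
input `D` and blank adaptation substrate, the process can halt with execution substrate `S` after
performing exactly `H` logical erasures on the adaptation substrate. -/
def Adapts (P : AdaptationProcess) (S₀ D S : List Bool) (H : ℕ) : Prop :=
  ∃ (k : ℕ) (D' W : List Bool),
    AdaptRun P.instr (0, S₀, D, []) H (k, S, D', W) ∧ P.instr (k, S, D', W) = none

end AdaptationProcess

/-! ## Energy -/

/-- Boltzmann's constant in joules per kelvin. -/
noncomputable def boltzmannConstant : ℝ := 1.380649e-23

/-- The Landauer cost `c = k_B T ln 2` of one erased bit at temperature `T`. -/
noncomputable def landauerCost (T : ℝ) : ℝ := boltzmannConstant * T * Real.log 2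

/-- The energetic data of a substrate: its overhead factor `F ≥ 1` relative to the Landauer
benchmark. -/
structure Substrate where
  overhead : ℝ
  one_le_overhead : 1 ≤ overhead

/-- The substrate-floor hypothesis (Landauer floor): `N` irreversible bit-operations on the
substrate at temperature `T` cost an energy `E ≥ F · N · c`. -/
def Substrate.EnergyFloor (X : Substrate) (T : ℝ) (N : ℕ) (E : ℝ) : Prop :=
  X.overhead * (N : ℝ) * landauerCost T ≤ E

/-! Since `I(S : σ) - I(D : σ) = K(σ | D) - K(σ | S)`, the claim is that `K(σ | D)` exceeds
`K(σ | S)` by at most the number of erasures, up to a constant. Given `D`, the final state `S` can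
be recomputed from the device, from `S₀` and from the bits that the erasures write, one bit for
each. The device is one of finitely many, but hard-wiring `S₀` costs an amount that depends on it.

What makes the constant uniform is that two strings `x` and `y` with `K(x) ≤ K(x | y) + b` cannot
both lie outside a finite set depending only on `b`. Enumerate the halting programs of `U`. Only
finitely many strings have a program before index `J`, and for large `J` the programs from `J` on
claim a measure of at most `2 ^ (-2 * g)`. If `y` is long, then its length is a stage by which most
of the measure has been claimed, so given `y` the programs in the tail can be recognized. By the
Kraft–Chaitin theorem they can be shortened by `2 * g` bits, at the cost of announcing `g`, which
takes `g` bits in unary, so that `K(x | y)` is smaller than `K(x)` by `g`, up to a constant.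

Hence `σ` or `S₀` ranges over a finite set. In the first case `K(σ | D)` is bounded, and in the
second one there are only finitely many pairs of a device and a state `S₀` to hard-wire.
-/

/-! ## Enumeration of partial recursive functions -/

/-- The output of the search with stages `s`, reported only at the last stage `k` at which it is
still missing. A search that is silent at first and never revises its output thus reports it once.
-/
def firstOutput {β : Type*} (s : ℕ → Option β) (k : ℕ) : Option β :=
  match s k with
  | none => s (k + 1)
  | some _ => none

section FirstOutput

variable {β : Type*} {s : ℕ → Option β} {k l : ℕ} {x x' : β}

theorem firstOutput_eq_some_iff :
    firstOutput s k = some x ↔ s k = none ∧ s (k + 1) = some x := by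
  cases h : s k <;> simp [firstOutput, h]

theorem exists_firstOutput_eq_some_iff (h₀ : s 0 = none)
    (hs : ∀ ⦃j k x⦄, j ≤ k → s j = some x → s k = some x) :
    (∃ k, firstOutput s k = some x) ↔ ∃ k, s k = some x := by
  simp only [firstOutput_eq_some_iff]
  refine ⟨fun ⟨k, _, hk⟩ => ⟨k + 1, hk⟩, fun ⟨k, hk⟩ => ?_⟩
  induction k with
  | zero => simp [h₀] at hk
  | succ k ih =>
    rcases hsk : s k with _ | x'
    · exact ⟨k, hsk, hk⟩
    · exact ih (hsk.trans ((hs k.le_succ hsk).symm.trans hk))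

theorem firstOutput_index_unique (hs : ∀ ⦃j k x⦄, j ≤ k → s j = some x → s k = some x)
    (hk : firstOutput s k = some x) (hl : firstOutput s l = some x') : k = l := by
  rw [firstOutput_eq_some_iff] at hk hl
  by_contra hne
  rcases Nat.lt_or_gt_of_ne hne with hlt | hlt
  · simpa [hl.1] using hs hlt hk.2
  · simpa [hk.1] using hs hlt hl.2

end FirstOutput

theorem computable_firstOutput {α β : Type*} [Primcodable α] [Primcodable β]
    {s : α → ℕ → Option β} (hs : Computable₂ s) :
    Computable₂ fun a k => firstOutput (s a) k := by
  refine (Computable.option_casesOn (g := fun _ _ => none) hs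
    (hs.comp Computable.fst (Computable.succ.comp Computable.snd))
    (Computable.const none).to₂).of_eq fun ⟨a, k⟩ => ?_
  cases h : s a k <;> simp [firstOutput, h]

section Enumeration

variable {α σ : Type*} [Primcodable α] [Primcodable σ] {f : α →. σ}

open Nat.Partrec (Code) in
theorem exists_computable_stages (hf : Partrec f) :
    ∃ s : α → ℕ → Option σ, Computable₂ s ∧ (∀ a, s a 0 = none) ∧
      (∀ a ⦃j k x⦄, j ≤ k → s a j = some x → s a k = some x) ∧
      ∀ a x, x ∈ f a ↔ ∃ k, s a k = some x := by
  obtain ⟨c, hc⟩ := Code.exists_code.1 hf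
  refine ⟨fun a k => (Code.evaln k c (Encodable.encode a)).bind Encodable.decode, ?_,
    fun a => by simp [Code.evaln], fun a j k x hjk hx => ?_, fun a x => ?_⟩
  · have hstage : Primrec fun b : α × ℕ => Code.evaln b.2 c (Encodable.encode b.1) :=
      Code.primrec_evaln.comp
        ((Primrec.snd.pair (Primrec.const c)).pair (Primrec.encode.comp Primrec.fst))
    exact (Primrec.option_bind hstage (Primrec.decode.comp Primrec.snd).to₂).to_comp
  · obtain ⟨n, hn, hx⟩ := Option.bind_eq_some_iff.1 hx
    exact Option.bind_eq_some_iff.2 ⟨n, Code.evaln_mono hjk hn, hx⟩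
  · have heval : c.eval (Encodable.encode a) = (f a).map Encodable.encode := by simp [hc]
    simp only [Option.bind_eq_some_iff]
    constructor
    · intro hx
      obtain ⟨k, hk⟩ := Code.evaln_complete.1 (heval ▸ Part.mem_map Encodable.encode hx)
      exact ⟨k, _, hk, Encodable.encodek x⟩
    · rintro ⟨k, n, hn, hx⟩
      have hmem := Code.evaln_sound hn
      rw [heval] at hmem
      obtain ⟨x', hx', rfl⟩ := (Part.mem_map_iff _).1 hmem
      rw [Encodable.encodek, Option.some_inj] at hx
      exact hx ▸ hx'

theorem exists_computable_enumeration (hf : Partrec f) :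
    ∃ e : ℕ → Option (α × σ), Computable e ∧
      (∀ a x, x ∈ f a ↔ ∃ i, e i = some (a, x)) ∧
      ∀ i j a x x', e i = some (a, x) → e j = some (a, x') → i = j := by
  obtain ⟨s, hs, hs₀, hmono, hmem⟩ := exists_computable_stages hf
  let e (i : ℕ) : Option (α × σ) :=
    (Encodable.decode₂ (α × ℕ) i).bind fun b => (firstOutput (s b.1) b.2).map (Prod.mk b.1)
  have he : ∀ {i a x}, e i = some (a, x) ↔
      ∃ k, Encodable.encode (a, k) = i ∧ firstOutput (s a) k = some x := by
    intro i a x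
    simp only [e, Option.bind_eq_some_iff, Option.map_eq_some_iff, Prod.mk.injEq,
      Encodable.decode₂_eq_some]
    constructor
    · rintro ⟨⟨_, k⟩, hi, x, hx, rfl, rfl⟩
      exact ⟨k, hi, hx⟩
    · rintro ⟨k, hi, hx⟩
      exact ⟨(a, k), hi, x, hx, rfl, rfl⟩
  refine ⟨e, ?_, fun a x => ?_, fun i j a x x' hi hj => ?_⟩
  · refine Computable.option_bind Primrec.decode₂.to_comp ?_
    exact Computable.option_map ((computable_firstOutput hs).comp
        (Computable.fst.comp Computable.snd) (Computable.snd.comp Computable.snd))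
      ((Computable.fst.comp (Computable.snd.comp Computable.fst)).pair Computable.snd).to₂
  · rw [hmem, ← exists_firstOutput_eq_some_iff (hs₀ a) (hmono a)]
    simp only [he]
    exact ⟨fun ⟨k, hk⟩ => ⟨_, k, rfl, hk⟩, fun ⟨_, k, _, hk⟩ => ⟨k, hk⟩⟩
  · obtain ⟨k, rfl, hk⟩ := he.1 hi
    obtain ⟨l, rfl, hl⟩ := he.1 hj
    rw [firstOutput_index_unique (hmono a) hk hl]

end Enumeration

/-! ## Binary intervals and the Kraft inequality -/

/-- The number with binary expansion `q`, most significant bit first. -/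
def binVal (q : List Bool) : ℕ :=
  q.foldl (fun n c => 2 * n + c.toNat) 0

theorem binVal_concat (q : List Bool) (c : Bool) :
    binVal (q ++ [c]) = 2 * binVal q + c.toNat := by
  simp [binVal]

theorem binVal_append_bounds (q r : List Bool) :
    binVal q * 2 ^ r.length ≤ binVal (q ++ r) ∧
      binVal (q ++ r) + 1 ≤ (binVal q + 1) * 2 ^ r.length := by
  induction r using List.reverseRecOn with
  | nil => simp
  | append_singleton r c ih =>
    rw [← List.append_assoc, binVal_concat]
    have hc : c.toNat ≤ 1 := Bool.toNat_le c
    simp only [List.length_append, List.length_cons, List.length_nil, zero_add, pow_succ]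
    constructor <;> nlinarith [ih.1, ih.2]

theorem exists_binVal_eq {l t : ℕ} (ht : t < 2 ^ l) :
    ∃ q : List Bool, q.length = l ∧ binVal q = t := by
  induction l generalizing t with
  | zero => exact ⟨[], rfl, by simp_all [binVal]⟩
  | succ l ih =>
    obtain ⟨q, hq, hv⟩ := ih (t := t / 2) (by rw [pow_succ] at ht; omega)
    refine ⟨q ++ [decide (t % 2 = 1)], by simp [hq], ?_⟩
    rw [binVal_concat, hv]
    rcases Nat.mod_two_eq_zero_or_one t with h | h <;> simp [h] <;> omega

/-- The interval of the reals in `[0, 1)` whose binary expansion starts with `q`. -/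
def cylinder (q : List Bool) : Set ℝ :=
  Set.Ico (binVal q / 2 ^ q.length) ((binVal q + 1) / 2 ^ q.length)

theorem cylinder_nonempty (q : List Bool) : (cylinder q).Nonempty :=
  Set.nonempty_Ico.2 (by gcongr; linarith)

theorem cylinder_subset_of_isPrefix {p q : List Bool} (h : p <+: q) : cylinder q ⊆ cylinder p := by
  obtain ⟨r, rfl⟩ := h
  have hbounds := binVal_append_bounds p r
  have hlow : (binVal p * 2 ^ r.length : ℝ) ≤ binVal (p ++ r) := by exact_mod_cast hbounds.1
  have hupp : (binVal (p ++ r) + 1 : ℝ) ≤ (binVal p + 1) * 2 ^ r.length := by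
    exact_mod_cast hbounds.2
  apply Set.Ico_subset_Ico <;>
    · rw [List.length_append, pow_add, div_le_div_iff₀ (by positivity) (by positivity)]
      nlinarith [show (0 : ℝ) < 2 ^ p.length by positivity]

/-- `q` is a word of length `l + 1` whose cylinder fits into the interval `[s, s + 2 ^ (-l))`. Such
an interval need not be aligned with the dyadic grid, hence the additional bit of `q`. -/
def FitsAt (s : ℝ) (l : ℕ) (q : List Bool) : Prop :=
  q.length = l + 1 ∧ cylinder q ⊆ Set.Ico s (s + (2 ^ l)⁻¹)

theorem exists_fitsAt {s : ℝ} {l : ℕ} (hs : 0 ≤ s) (hs' : s + (2 ^ l)⁻¹ ≤ 1) :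
    ∃ q, FitsAt s l q := by
  have hpow : (0 : ℝ) < 2 ^ (l + 1) := by positivity
  have hscale : (s + (2 ^ l)⁻¹) * 2 ^ (l + 1) = s * 2 ^ (l + 1) + 2 := by
    rw [add_mul, pow_succ, ← mul_assoc (2 ^ l : ℝ)⁻¹, inv_mul_cancel₀ (by positivity), one_mul]
  have hroom : s * 2 ^ (l + 1) + 2 ≤ 2 ^ (l + 1) := by nlinarith
  have hceil := Nat.le_ceil (s * 2 ^ (l + 1))
  have hceil' := Nat.ceil_lt_add_one (show 0 ≤ s * 2 ^ (l + 1) by positivity)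
  have hlt : ⌈s * 2 ^ (l + 1)⌉₊ < 2 ^ (l + 1) := by
    have : (⌈s * 2 ^ (l + 1)⌉₊ : ℝ) < ((2 ^ (l + 1) : ℕ) : ℝ) := by push_cast; linarith
    exact_mod_cast this
  obtain ⟨q, hq, hval⟩ := exists_binVal_eq hlt
  refine ⟨q, hq, Set.Ico_subset_Ico ?_ ?_⟩
  · rwa [hq, hval, le_div_iff₀ hpow]
  · rw [hq, hval, div_le_iff₀ hpow, hscale]
    linarith

open InformationTheory in
theorem uniquelyDecodable_of_prefix_free {α : Type*} {S : Set (List α)} (hnil : [] ∉ S)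
    (hS : ∀ u ∈ S, ∀ v ∈ S, u <+: v → u = v) : UniquelyDecodable S := by
  intro L₁
  induction L₁ with
  | nil =>
    rintro (_ | ⟨v, L₂⟩) - h₂ h
    · rfl
    · simp only [List.flatten_nil, List.flatten_cons, List.nil_eq, List.append_eq_nil_iff] at h
      exact absurd (h.1 ▸ h₂ v List.mem_cons_self) hnil
  | cons u L₁ ih =>
    rintro (_ | ⟨v, L₂⟩) h₁ h₂ h
    · simp only [List.flatten_nil, List.flatten_cons, List.append_eq_nil_iff] at h
      exact absurd (h.1 ▸ h₁ u List.mem_cons_self) hnil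
    · simp only [List.flatten_cons] at h
      obtain rfl : u = v := by
        have hu := h₁ u List.mem_cons_self
        have hv := h₂ v List.mem_cons_self
        rcases List.prefix_or_prefix_of_prefix (List.prefix_append u _)
          (h ▸ List.prefix_append v _) with huv | hvu
        · exact hS u hu v hv huv
        · exact (hS v hv u hu hvu).symm
      rw [ih L₂ (fun w hw => h₁ w (List.mem_cons_of_mem _ hw))
        (fun w hw => h₂ w (List.mem_cons_of_mem _ hw)) (List.append_cancel_left h)]

theorem sum_inv_two_pow_length_le_one {S : Finset (List Bool)}
    (hS : ∀ u ∈ S, ∀ v ∈ S, u <+: v → u = v) : ∑ u ∈ S, ((2 : ℝ) ^ u.length)⁻¹ ≤ 1 := by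
  by_cases hnil : [] ∈ S
  · have : S = {[]} := Finset.eq_singleton_iff_unique_mem.2
      ⟨hnil, fun u hu => (hS [] hnil u hu u.nil_prefix).symm⟩
    simp [this]
  · simpa using InformationTheory.kraft_mcmillan_inequality
      (S := S)
      (uniquelyDecodable_of_prefix_free (by simpa using hnil) (by simpa using hS))

/-! ## Request sequences -/

/-- A sequence of requests in the sense of the Kraft–Chaitin theorem: the entry `some (l, x)` asks
for a codeword of length about `l` for the string `x`; the entry `none` asks for nothing. -/
abbrev RequestSeq : Type := ℕ → Option (ℕ × List Bool)

namespace RequestSeq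

variable {r : RequestSeq} {i j l : ℕ} {x : List Bool}

/-- The measure `2 ^ (-l)` claimed by the `i`-th request. -/
noncomputable def weight (r : RequestSeq) (i : ℕ) : ℝ :=
  (r i).elim 0 fun a => (2 ^ a.1)⁻¹

theorem weight_nonneg (r : RequestSeq) (i : ℕ) : 0 ≤ r.weight i := by
  cases h : r i <;> simp [weight, h]

theorem weight_of_eq_some (h : r i = some (l, x)) : r.weight i = (2 ^ l)⁻¹ := by
  simp [weight, h]

/-- The measure claimed by the requests of index below `n`. -/
noncomputable def kraftSum (r : RequestSeq) (n : ℕ) : ℝ :=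
  ∑ j ∈ Finset.range n, r.weight j

theorem kraftSum_succ (r : RequestSeq) (n : ℕ) :
    r.kraftSum (n + 1) = r.kraftSum n + r.weight n :=
  Finset.sum_range_succ _ _

theorem kraftSum_mono (r : RequestSeq) : Monotone r.kraftSum :=
  monotone_nat_of_le_succ fun n => by linarith [r.kraftSum_succ n, r.weight_nonneg n]

theorem kraftSum_nonneg (r : RequestSeq) (n : ℕ) : 0 ≤ r.kraftSum n :=
  Finset.sum_nonneg fun j _ => r.weight_nonneg j

theorem kraftSum_le_one_of_prefix_free {e : ℕ → Option (List Bool × List Bool)}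
    (he : ∀ i j a b, e i = some a → e j = some b → a.1 <+: b.1 → i = j) (n : ℕ) :
    kraftSum (fun i => (e i).map (Prod.map List.length id)) n ≤ 1 := by
  let words (i : ℕ) : Finset (List Bool) := ((e i).map Prod.fst).toFinset
  have hwords : ∀ {i u}, u ∈ words i → ∃ x, e i = some (u, x) := by simp [words]
  have hdisj : (Finset.range n : Set ℕ).PairwiseDisjoint words := by
    refine fun i _ j _ hij => Finset.disjoint_left.2 fun u hi hj => hij ?_
    obtain ⟨x, hx⟩ := hwords hi
    obtain ⟨y, hy⟩ := hwords hj
    exact he i j _ _ hx hy List.prefix_rfl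
  calc ∑ i ∈ Finset.range n, weight (fun i => (e i).map (Prod.map List.length id)) i
      = ∑ i ∈ Finset.range n, ∑ u ∈ words i, ((2 : ℝ) ^ u.length)⁻¹ :=
        Finset.sum_congr rfl fun i _ => by cases h : e i <;> simp [weight, words, h]
    _ = ∑ u ∈ (Finset.range n).biUnion words, ((2 : ℝ) ^ u.length)⁻¹ :=
        (Finset.sum_biUnion hdisj).symm
    _ ≤ 1 := by
        refine sum_inv_two_pow_length_le_one fun u hu v hv huv => ?_
        obtain ⟨i, -, hi⟩ := Finset.mem_biUnion.1 hu
        obtain ⟨j, -, hj⟩ := Finset.mem_biUnion.1 hv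
        obtain ⟨x, hx⟩ := hwords hi
        obtain ⟨y, hy⟩ := hwords hj
        obtain rfl := he i j _ _ hx hy huv
        simp_all

theorem Ico_kraftSum (hi : r i = some (l, x)) :
    Set.Ico (r.kraftSum i) (r.kraftSum i + (2 ^ l)⁻¹) =
      Set.Ico (r.kraftSum i) (r.kraftSum (i + 1)) := by
  rw [kraftSum_succ, weight_of_eq_some hi]

/-- `q` is a codeword for the `i`-th request: successive requests are allotted successive intervals
of the length they claim, and `q` fits into the `i`-th one. -/
def IsCodeword (r : RequestSeq) (i : ℕ) (q : List Bool) : Prop :=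
  ∃ a, r i = some a ∧ FitsAt (r.kraftSum i) a.1 q

theorem IsCodeword.eq_of_isPrefix {q q' : List Bool} (hq : r.IsCodeword i q)
    (hq' : r.IsCodeword j q') (h : q <+: q') : i = j ∧ q = q' := by
  obtain ⟨⟨l, x⟩, hi, hlen, hsub⟩ := hq
  obtain ⟨⟨l', x'⟩, hj, hlen', hsub'⟩ := hq'
  obtain ⟨t, ht⟩ := cylinder_nonempty q'
  rw [Ico_kraftSum hi] at hsub
  rw [Ico_kraftSum hj] at hsub'
  obtain rfl : i = j := by
    by_contra hne
    exact Set.disjoint_left.1 (r.kraftSum_mono.pairwise_disjoint_on_Ico_succ hne)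
      (hsub (cylinder_subset_of_isPrefix h ht)) (hsub' ht)
  obtain ⟨rfl, -⟩ : l = l' ∧ x = x' := by simpa using hi.symm.trans hj
  exact ⟨rfl, h.eq_of_length (hlen.trans hlen'.symm)⟩

theorem exists_isCodeword (hi : r i = some (l, x)) (hsum : r.kraftSum (i + 1) ≤ 1) :
    ∃ q, r.IsCodeword i q ∧ q.length = l + 1 := by
  rw [kraftSum_succ, weight_of_eq_some hi] at hsum
  obtain ⟨q, hq⟩ := exists_fitsAt (r.kraftSum_nonneg i) hsum
  exact ⟨q, ⟨_, hi, hq⟩, hq.1⟩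

end RequestSeq

/-! ## Dyadic arithmetic -/

theorem primrec_binVal : Primrec binVal := by
  refine Primrec.list_foldl (h := fun (_ : List Bool) (p : ℕ × Bool) => 2 * p.1 + p.2.toNat)
    Primrec.id (Primrec.const 0) ?_
  exact Primrec.nat_add.comp
    (Primrec.nat_mul.comp (Primrec.const 2) (Primrec.fst.comp Primrec.snd))
    ((Primrec.dom_finite Bool.toNat).comp (Primrec.snd.comp Primrec.snd))

theorem primrec_two_pow : Primrec fun n : ℕ => 2 ^ n :=
  (Primrec₂.unpaired'.1 Nat.Primrec.pow).comp (Primrec.const 2) Primrec.id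

/-- The dyadic number represented by a numerator and an exponent. Pairs of naturals stand in for
the partial sums of the Kraft series wherever these have to be computed. -/
noncomputable def dyadicReal (a : ℕ × ℕ) : ℝ := a.1 / 2 ^ a.2

/-- Addition of dyadic numbers, without reduction to lowest terms. -/
def dyadicAdd (a b : ℕ × ℕ) : ℕ × ℕ := (a.1 * 2 ^ b.2 + b.1 * 2 ^ a.2, a.2 + b.2)

theorem dyadicReal_dyadicAdd (a b : ℕ × ℕ) :
    dyadicReal (dyadicAdd a b) = dyadicReal a + dyadicReal b := by
  simp only [dyadicReal, dyadicAdd, pow_add]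
  push_cast
  field_simp

theorem dyadicReal_one_left (l : ℕ) : dyadicReal (1, l) = (2 ^ l)⁻¹ := by
  simp [dyadicReal]

theorem primrec_dyadicAdd : Primrec₂ dyadicAdd := by
  have hnum {f g : (ℕ × ℕ) × ℕ × ℕ → ℕ × ℕ} (hf : Primrec f) (hg : Primrec g) :
      Primrec fun c => (f c).1 * 2 ^ (g c).2 :=
    Primrec.nat_mul.comp (Primrec.fst.comp hf) (primrec_two_pow.comp (Primrec.snd.comp hg))
  exact (Primrec.nat_add.comp (hnum Primrec.fst Primrec.snd) (hnum Primrec.snd Primrec.fst)).pair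
    (Primrec.nat_add.comp (Primrec.snd.comp Primrec.fst) (Primrec.snd.comp Primrec.snd))

theorem primrecRel_dyadicReal_le : PrimrecRel fun a b => dyadicReal a ≤ dyadicReal b := by
  have hnat : PrimrecRel fun a b : ℕ × ℕ => a.1 * 2 ^ b.2 ≤ b.1 * 2 ^ a.2 :=
    Primrec.nat_le.comp
      (Primrec.nat_mul.comp (Primrec.fst.comp Primrec.fst)
        (primrec_two_pow.comp (Primrec.snd.comp Primrec.snd)))
      (Primrec.nat_mul.comp (Primrec.fst.comp Primrec.snd)
        (primrec_two_pow.comp (Primrec.snd.comp Primrec.fst)))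
  refine hnat.of_eq fun a b => ?_
  rw [dyadicReal, dyadicReal, div_le_div_iff₀ (by positivity) (by positivity)]
  exact_mod_cast Iff.rfl

theorem fitsAt_dyadicReal_iff {a : ℕ × ℕ} {l : ℕ} {q : List Bool} :
    FitsAt (dyadicReal a) l q ↔ q.length = l + 1 ∧
      dyadicReal a ≤ dyadicReal (binVal q, q.length) ∧
        dyadicReal (binVal q + 1, q.length) ≤ dyadicReal (dyadicAdd a (1, l)) := by
  rw [FitsAt, cylinder, Set.Ico_subset_Ico_iff (Set.nonempty_Ico.1 (cylinder_nonempty q)),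
    dyadicReal_dyadicAdd, dyadicReal_one_left]
  simp only [dyadicReal, Nat.cast_add, Nat.cast_one]

theorem primrecPred_fitsAt :
    PrimrecPred fun b : (ℕ × ℕ) × ℕ × List Bool => FitsAt (dyadicReal b.1) b.2.1 b.2.2 := by
  have hl : Primrec fun b : (ℕ × ℕ) × ℕ × List Bool => b.2.1 := Primrec.fst.comp Primrec.snd
  have hlen : Primrec fun b : (ℕ × ℕ) × ℕ × List Bool => b.2.2.length :=
    Primrec.list_length.comp (Primrec.snd.comp Primrec.snd)
  have hval : Primrec fun b : (ℕ × ℕ) × ℕ × List Bool => binVal b.2.2 :=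
    primrec_binVal.comp (Primrec.snd.comp Primrec.snd)
  exact ((Primrec.eq.comp hlen (Primrec.succ.comp hl)).and
    ((primrecRel_dyadicReal_le.comp Primrec.fst (hval.pair hlen)).and
      (primrecRel_dyadicReal_le.comp ((Primrec.succ.comp hval).pair hlen)
        (primrec_dyadicAdd.comp Primrec.fst ((Primrec.const 1).pair hl))))).of_eq
    fun _ => fitsAt_dyadicReal_iff.symm

namespace RequestSeq

variable {r : RequestSeq} {i : ℕ} {x q : List Bool}

/-- The dyadic representation of `kraftSum`. -/
def kraftPair (r : RequestSeq) : ℕ → ℕ × ℕ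
  | 0 => (0, 0)
  | n + 1 => (r n).elim (kraftPair r n) fun a => dyadicAdd (kraftPair r n) (1, a.1)

theorem dyadicReal_kraftPair (r : RequestSeq) (n : ℕ) :
    dyadicReal (r.kraftPair n) = r.kraftSum n := by
  induction n with
  | zero => simp [kraftPair, dyadicReal, kraftSum]
  | succ n ih =>
    rw [kraftSum_succ]
    rcases h : r n with _ | a <;>
      simp [kraftPair, weight, h, ih, dyadicReal_dyadicAdd, dyadicReal_one_left]

theorem computable_kraftPair {α : Type*} [Primcodable α] {r : α → RequestSeq}
    (hr : Computable₂ fun a i => r a i) : Computable₂ fun a n => (r a).kraftPair n := by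
  refine (Computable.nat_rec (h := fun a b => (r a.1 b.1).elim b.2 fun c => dyadicAdd b.2 (1, c.1))
    Computable.snd (Computable.const (0, 0)) ?_).of_eq fun ⟨a, n⟩ => ?_
  · refine (Computable.option_casesOn (g := fun b c => dyadicAdd b.2.2 (1, c.1))
      (hr.comp (Computable.fst.comp Computable.fst) (Computable.fst.comp Computable.snd))
      (Computable.snd.comp Computable.snd) ?_).of_eq fun ⟨a, b⟩ => ?_
    · exact primrec_dyadicAdd.to_comp.comp
        (Computable.snd.comp (Computable.snd.comp Computable.fst))
        ((Computable.const 1).pair (Computable.fst.comp Computable.snd))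
    · cases h : r a.1 b.1 <;> simp [h]
  · induction n with
    | zero => rfl
    | succ n ih => simp only [kraftPair, ← ih]

open Classical in
/-- The string requested at index `i`, if `q` is a codeword for that request. -/
noncomputable def decode (r : RequestSeq) (i : ℕ) (q : List Bool) : Option (List Bool) :=
  (r i).bind fun a => if FitsAt (r.kraftSum i) a.1 q then some a.2 else none

theorem decode_eq_some_iff :
    r.decode i q = some x ↔ r.IsCodeword i q ∧ ∃ l, r i = some (l, x) := by
  rcases h : r i with _ | ⟨l, x'⟩ <;> simp [decode, IsCodeword, h]

theorem computable_decode {α : Type*} [Primcodable α] {r : α → RequestSeq}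
    (hr : Computable₂ fun a i => r a i) :
    Computable fun b : α × ℕ × List Bool => (r b.1).decode b.2.1 b.2.2 := by
  classical
  have hselect : Computable fun b : (ℕ × ℕ) × ℕ × List Bool × List Bool =>
      if FitsAt (dyadicReal b.1) b.2.1 b.2.2.1 then some b.2.2.2 else none :=
    (Primrec.ite (primrecPred_fitsAt.comp (Primrec.fst.pair
        ((Primrec.fst.comp Primrec.snd).pair (Primrec.fst.comp (Primrec.snd.comp Primrec.snd)))))
      (Primrec.option_some.comp (Primrec.snd.comp (Primrec.snd.comp Primrec.snd)))
      (Primrec.const none)).to_comp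
  have hi : Computable fun b : α × ℕ × List Bool => b.2.1 := Computable.fst.comp Computable.snd
  have hq : Computable fun b : α × ℕ × List Bool => b.2.2 := Computable.snd.comp Computable.snd
  refine (Computable.option_bind (hr.comp Computable.fst hi) (hselect.comp
    ((((computable_kraftPair hr).comp Computable.fst hi).comp Computable.fst).pair
      ((Computable.fst.comp Computable.snd).pair
        ((hq.comp Computable.fst).pair (Computable.snd.comp Computable.snd))))).to₂).of_eq
    fun b => ?_
  simp only [decode, dyadicReal_kraftPair]

end RequestSeq

/-! ## Prefix machines -/

namespace PrefixMachine

theorem exists_of_search {ι : Type*} [Primcodable ι]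
    {f : List Bool × List Bool → ι → Option (List Bool)} (hf : Computable₂ f)
    (hdet : ∀ p q y i j x x', p <+: q → f (p, y) i = some x → f (q, y) j = some x' →
      p = q ∧ x = x') :
    ∃ V : PrefixMachine, ∀ p y i x, f (p, y) i = some x → x ∈ V.eval p y := by
  let search (a : List Bool × List Bool) (n : ℕ) : Option (List Bool) :=
    (Encodable.decode (α := ι) n).bind (f a)
  have hwitness : ∀ {a n x}, x ∈ search a n → ∃ i, f a i = some x := fun h =>
    let ⟨i, _, hi⟩ := Option.bind_eq_some_iff.1 h
    ⟨i, hi⟩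
  refine ⟨⟨fun p y => Nat.rfindOpt (search (p, y)), Partrec.rfindOpt ?_, ?_⟩, fun p y i x hi => ?_⟩
  · exact Computable.option_bind (Computable.decode.comp Computable.snd)
      (hf.comp (Computable.fst.comp Computable.fst) Computable.snd)
  · intro y p q hp hq hpq
    obtain ⟨_, x, hx⟩ := Nat.rfindOpt_dom.1 hp
    obtain ⟨_, x', hx'⟩ := Nat.rfindOpt_dom.1 hq
    obtain ⟨i, hi⟩ := hwitness hx
    obtain ⟨j, hj⟩ := hwitness hx'
    exact (hdet p q y i j x x' hpq hi hj).1
  · have hdom : (Nat.rfindOpt (search (p, y))).Dom :=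
      Nat.rfindOpt_dom.2 ⟨Encodable.encode i, x, by simp [search, hi]⟩
    have hget := Part.get_mem hdom
    obtain ⟨_, hfound⟩ := Nat.rfindOpt_spec hget
    obtain ⟨j, hj⟩ := hwitness hfound
    rw [(hdet p p y i j x _ List.prefix_rfl hi hj).2]
    exact hget

variable {U : PrefixMachine}

theorem condK_le_length {p x y : List Bool} (h : x ∈ U.eval p y) : U.condK x y ≤ p.length :=
  Nat.sInf_le ⟨p, rfl, h⟩

theorem exists_eval_nil (x : List Bool) : ∃ V : PrefixMachine, ∀ y, x ∈ V.eval [] y := by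
  let f (a : List Bool × List Bool) (_ : Unit) : Option (List Bool) :=
    if a.1 = [] then some x else none
  have hf : Computable₂ f :=
    (Primrec.ite (Primrec.eq.comp (Primrec.fst.comp Primrec.fst) (Primrec.const []))
      (Primrec.const (some x)) (Primrec.const none)).to_comp
  obtain ⟨V, hV⟩ := exists_of_search hf fun p q y i j x₁ x₂ _ h₁ h₂ => by grind
  exact ⟨V, fun y => hV [] y () x (if_pos rfl)⟩

namespace IsUniversal

theorem exists_program (hU : U.IsUniversal) (x y : List Bool) :
    ∃ p, p.length = U.condK x y ∧ x ∈ U.eval p y := by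
  obtain ⟨V, hV⟩ := exists_eval_nil x
  obtain ⟨d, hd⟩ := hU V
  obtain ⟨q, -, hq⟩ := hd [] y x (hV y)
  exact Nat.sInf_mem (s := {n | ∃ p : List Bool, p.length = n ∧ x ∈ U.eval p y}) ⟨_, q, rfl, hq⟩

theorem exists_condK_le_of_machine (hU : U.IsUniversal) (V : PrefixMachine) :
    ∃ d, ∀ p y x, x ∈ V.eval p y → U.condK x y ≤ p.length + d := by
  obtain ⟨d, hd⟩ := hU V
  refine ⟨d, fun p y x h => ?_⟩
  obtain ⟨q, hlen, hq⟩ := hd p y x h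
  exact (condK_le_length hq).trans hlen

theorem exists_condK_le (hU : U.IsUniversal) (x : List Bool) : ∃ d, ∀ y, U.condK x y ≤ d := by
  obtain ⟨V, hV⟩ := exists_eval_nil x
  obtain ⟨d, hd⟩ := hU.exists_condK_le_of_machine V
  exact ⟨[].length + d, fun y => hd [] y x (hV y)⟩

theorem finite_setOf_K_le (hU : U.IsUniversal) (b : ℕ) : {x | U.K x ≤ b}.Finite := by
  choose p hlen heval using fun x => hU.exists_program x []
  refine Set.Finite.of_finite_image (f := p) ((List.finite_length_le Bool b).subset ?_) ?_
  · rintro _ ⟨x, hx, rfl⟩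
    exact (hlen x).trans_le hx
  · intro x _ y _ hxy
    exact Part.mem_unique (heval x) (hxy ▸ heval y)

end IsUniversal

end PrefixMachine

/-! ## The Kraft–Chaitin theorem -/

/-- The word `q` preceded by a self-delimiting code for the number `g`. -/
def unaryCode (g : ℕ) (q : List Bool) : List Bool :=
  (List.cons true)^[g] (false :: q)

theorem unaryCode_zero (q : List Bool) : unaryCode 0 q = false :: q := rfl

theorem unaryCode_succ (g : ℕ) (q : List Bool) : unaryCode (g + 1) q = true :: unaryCode g q :=
  Function.iterate_succ_apply' _ _ _

theorem length_unaryCode (g : ℕ) (q : List Bool) : (unaryCode g q).length = g + 1 + q.length := by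
  induction g with
  | zero => simp [unaryCode_zero, add_comm]
  | succ g ih =>
    rw [unaryCode_succ, List.length_cons, ih]
    omega

theorem eq_and_isPrefix_of_unaryCode_isPrefix {g g' : ℕ} {q q' : List Bool}
    (h : unaryCode g q <+: unaryCode g' q') : g = g' ∧ q <+: q' := by
  induction g generalizing g' with
  | zero =>
    cases g' with
    | zero => simpa [unaryCode_zero] using h
    | succ g' => simp [unaryCode_zero, unaryCode_succ] at h
  | succ g ih =>
    cases g' with
    | zero => simp [unaryCode_zero, unaryCode_succ] at h
    | succ g' =>
      rw [unaryCode_succ, unaryCode_succ, List.cons_prefix_cons] at h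
      exact (ih h.2).imp_left (congrArg _)

theorem primrec_unaryCode : Primrec₂ unaryCode :=
  Primrec.nat_iterate Primrec.fst (Primrec.list_cons.comp (Primrec.const false) Primrec.snd)
    (Primrec.list_cons.comp (Primrec.const true) Primrec.snd).to₂

namespace RequestSeq

theorem exists_machine {r : ℕ × List Bool → RequestSeq} (hr : Computable₂ fun a i => r a i) :
    ∃ V : PrefixMachine, ∀ g y i l x, r (g, y) i = some (l, x) →
      (r (g, y)).kraftSum (i + 1) ≤ 1 → ∃ p, p.length = l + g + 2 ∧ x ∈ V.eval p y := by
  let f (a : List Bool × List Bool) (b : ℕ × ℕ × List Bool) : Option (List Bool) :=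
    if a.1 = unaryCode b.1 b.2.2 then (r (b.1, a.2)).decode b.2.1 b.2.2 else none
  have hf : Computable₂ f := by
    have hmatch : Primrec fun c : (List Bool × List Bool) × ℕ × ℕ × List Bool =>
        decide (c.1.1 = unaryCode c.2.1 c.2.2.2) :=
      (Primrec.eq.comp (Primrec.fst.comp Primrec.fst)
        (primrec_unaryCode.comp (Primrec.fst.comp Primrec.snd)
          (Primrec.snd.comp (Primrec.snd.comp Primrec.snd)))).decide
    have hdecode : Computable fun c : (List Bool × List Bool) × ℕ × ℕ × List Bool =>
        (r (c.2.1, c.1.2)).decode c.2.2.1 c.2.2.2 :=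
      (computable_decode hr).comp (((Computable.fst.comp Computable.snd).pair
        (Computable.snd.comp Computable.fst)).pair (Computable.snd.comp Computable.snd))
    exact (Computable.cond hmatch.to_comp hdecode (Computable.const none)).of_eq fun c =>
      Bool.cond_decide _ _ _
  have hmem : ∀ {p y g i q x}, f (p, y) (g, i, q) = some x →
      p = unaryCode g q ∧ (r (g, y)).decode i q = some x := fun {p y g i q x} h => by
    simpa [f] using h
  have hdet : ∀ p p' y b b' x x', p <+: p' → f (p, y) b = some x → f (p', y) b' = some x' →
      p = p' ∧ x = x' := by
    rintro _ _ y ⟨g, i, q⟩ ⟨g', j, q'⟩ x x' hpp hx hx'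
    obtain ⟨rfl, hout⟩ := hmem hx
    obtain ⟨rfl, hout'⟩ := hmem hx'
    obtain ⟨rfl, hqq'⟩ := eq_and_isPrefix_of_unaryCode_isPrefix hpp
    obtain ⟨rfl, rfl⟩ :=
      (decode_eq_some_iff.1 hout).1.eq_of_isPrefix (decode_eq_some_iff.1 hout').1 hqq'
    exact ⟨rfl, Option.some_inj.1 (hout.symm.trans hout')⟩
  obtain ⟨V, hV⟩ := PrefixMachine.exists_of_search hf hdet
  refine ⟨V, fun g y i l x hi hsum => ?_⟩
  obtain ⟨q, hq, hlen⟩ := exists_isCodeword hi hsum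
  refine ⟨unaryCode g q, by rw [length_unaryCode, hlen]; omega, hV _ y (g, i, q) x ?_⟩
  exact (if_pos rfl).trans (decode_eq_some_iff.2 ⟨hq, l, hi⟩)

end RequestSeq

/-! ## Independence of strings -/

namespace RequestSeq

variable {r : RequestSeq} {N h i l : ℕ} {x : List Bool}

theorem exists_kraftSum_le_add (hr : ∀ n, r.kraftSum n ≤ 1) {ε : ℝ} (hε : 0 < ε) :
    ∃ J, ∀ n, r.kraftSum n ≤ r.kraftSum J + ε := by
  have hbdd : BddAbove (Set.range r.kraftSum) := ⟨1, Set.forall_mem_range.2 hr⟩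
  obtain ⟨J, hJ⟩ := exists_lt_of_lt_ciSup (sub_lt_self (⨆ n, r.kraftSum n) hε)
  exact ⟨J, fun n => (le_ciSup hbdd n).trans (by linarith)⟩

/-- At stage `N`, the index `i` belongs to the tail of the request sequence: the requests known by
then, from index `i` on, claim a measure of at most `2 ^ (-h - 1)`. -/
def InTail (r : RequestSeq) (N h i : ℕ) : Prop :=
  r.kraftSum N ≤ r.kraftSum i + (2 ^ (h + 1))⁻¹

open Classical in
/-- The requests that belong to the tail at stage `N`, each shortened by `h` bits. -/
noncomputable def tailRequests (r : RequestSeq) (N h : ℕ) : RequestSeq := fun i =>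
  if r.InTail N h i then (r i).map (Prod.map (· - h) id) else none

theorem InTail.kraftSum_le (hi : r.InTail N h i)
    (hN : ∀ n, r.kraftSum n ≤ r.kraftSum N + (2 ^ (h + 1))⁻¹) (n : ℕ) :
    r.kraftSum n ≤ r.kraftSum i + (2 ^ h)⁻¹ := by
  have hhalves : (2 ^ (h + 1) : ℝ)⁻¹ + (2 ^ (h + 1))⁻¹ = (2 ^ h)⁻¹ := by
    rw [pow_succ, mul_inv]
    ring
  rw [InTail] at hi
  linarith [hN n]

theorem InTail.le_of_eq_some (hi : r.InTail N h i)
    (hN : ∀ n, r.kraftSum n ≤ r.kraftSum N + (2 ^ (h + 1))⁻¹) (hx : r i = some (l, x)) :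
    h ≤ l := by
  have hsum := hi.kraftSum_le hN (i + 1)
  rw [kraftSum_succ, weight_of_eq_some hx, add_le_add_iff_left,
    inv_le_inv₀ (by positivity) (by positivity)] at hsum
  exact (pow_le_pow_iff_right₀ one_lt_two).1 hsum

theorem InTail.weight_tailRequests (hi : r.InTail N h i)
    (hN : ∀ n, r.kraftSum n ≤ r.kraftSum N + (2 ^ (h + 1))⁻¹) :
    (r.tailRequests N h).weight i = 2 ^ h * r.weight i := by
  rcases hx : r i with _ | ⟨l, x⟩
  · simp [weight, tailRequests, hx]
  · obtain ⟨m, rfl⟩ := Nat.exists_eq_add_of_le (hi.le_of_eq_some hN hx)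
    have htail : r.tailRequests N h i = some (m, x) := by simp [tailRequests, hi, hx]
    rw [weight_of_eq_some hx, weight_of_eq_some htail, pow_add]
    field_simp

theorem kraftSum_tailRequests_le_one (hN : ∀ n, r.kraftSum n ≤ r.kraftSum N + (2 ^ (h + 1))⁻¹)
    (n : ℕ) : (r.tailRequests N h).kraftSum n ≤ 1 := by
  -- `i` is the first index in the tail, or `n` if the tail has not been reached.
  obtain ⟨i, hsum, hi⟩ : ∃ i,
      (r.tailRequests N h).kraftSum n ≤ 2 ^ h * (r.kraftSum n - r.kraftSum i) ∧
        (i = n ∨ r.InTail N h i) := by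
    induction n with
    | zero => exact ⟨0, by simp [kraftSum], Or.inl rfl⟩
    | succ n ih =>
      obtain ⟨i, hsum, hi⟩ := ih
      by_cases hn : r.InTail N h n
      · refine ⟨i, ?_, Or.inr (hi.elim (· ▸ hn) id)⟩
        rw [kraftSum_succ, kraftSum_succ, hn.weight_tailRequests hN]
        linarith
      · have hweight : (r.tailRequests N h).weight n = 0 := by simp [weight, tailRequests, hn]
        rcases hi with rfl | hi
        · exact ⟨i + 1, by simpa [kraftSum_succ _ i, hweight] using hsum, Or.inl rfl⟩
        · refine ⟨i, ?_, Or.inr hi⟩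
          rw [kraftSum_succ, hweight, add_zero]
          exact hsum.trans (by gcongr; exact r.kraftSum_mono n.le_succ)
  rcases hi with rfl | hi
  · linarith
  · calc (r.tailRequests N h).kraftSum n ≤ 2 ^ h * (r.kraftSum n - r.kraftSum i) := hsum
      _ ≤ 2 ^ h * (2 ^ h)⁻¹ := by gcongr; linarith [hi.kraftSum_le hN n]
      _ = 1 := mul_inv_cancel₀ (by positivity)

theorem computable_tailRequests {α : Type*} [Primcodable α] {N h : α → ℕ} (hr : Computable r)
    (hN : Computable N) (hh : Computable h) :
    Computable₂ fun a i => r.tailRequests (N a) (h a) i := by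
  classical
  have hpair : Computable r.kraftPair :=
    (computable_kraftPair (r := fun _ : Unit => r) (hr.comp Computable.snd).to₂).comp
      (Computable.const ()) Computable.id
  have hle : Computable fun b : α × ℕ => decide
      (dyadicReal (r.kraftPair (N b.1)) ≤
        dyadicReal (dyadicAdd (r.kraftPair b.2) (1, h b.1 + 1))) :=
    primrecRel_dyadicReal_le.decide.to_comp.comp (hpair.comp (hN.comp Computable.fst))
      (primrec_dyadicAdd.to_comp.comp (hpair.comp Computable.snd)
        ((Computable.const 1).pair (Computable.succ.comp (hh.comp Computable.fst))))
  have hshorten : Computable fun b : α × ℕ => (r b.2).map (Prod.map (· - h b.1) id) :=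
    Computable.option_map (hr.comp Computable.snd)
      ((Primrec.nat_sub.to_comp.comp (Computable.fst.comp Computable.snd)
        (hh.comp (Computable.fst.comp Computable.fst))).pair
          (Computable.snd.comp Computable.snd)).to₂
  refine (Computable.cond hle hshorten (Computable.const none)).of_eq fun b => ?_
  rw [Bool.cond_decide]
  refine if_congr ?_ rfl rfl
  rw [InTail, dyadicReal_dyadicAdd, dyadicReal_kraftPair, dyadicReal_kraftPair, dyadicReal_one_left]

end RequestSeq

namespace PrefixMachine

variable {U : PrefixMachine}

theorem exists_programRequests (U : PrefixMachine) :
    ∃ r : RequestSeq, Computable r ∧ (∀ n, r.kraftSum n ≤ 1) ∧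
      ∀ p x, x ∈ U.eval p [] → ∃ i, r i = some (p.length, x) := by
  have hU : Partrec fun p => U.eval p [] := U.partrec.comp Computable.id (Computable.const [])
  obtain ⟨e, he, hcomplete, hunique⟩ := exists_computable_enumeration hU
  refine ⟨fun i => (e i).map (Prod.map List.length id), ?_, ?_, fun p x hx => ?_⟩
  · exact Computable.option_map he ((Primrec.list_length.comp (Primrec.fst.comp Primrec.snd)).pair
      (Primrec.snd.comp Primrec.snd)).to_comp.to₂
  · refine RequestSeq.kraftSum_le_one_of_prefix_free fun i j ⟨p, x⟩ ⟨q, x'⟩ hi hj hpq => ?_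
    obtain rfl : p = q := U.prefix_free [] p q (Part.dom_iff_mem.2 ⟨x, (hcomplete p x).2 ⟨i, hi⟩⟩)
      (Part.dom_iff_mem.2 ⟨x', (hcomplete q x').2 ⟨j, hj⟩⟩) hpq
    exact hunique i j p x x' hi hj
  · obtain ⟨i, hi⟩ := (hcomplete p x).1 hx
    exact ⟨i, by simp [hi]⟩

-- Given `y`, the requests in the tail at stage `y.length` can be shortened by `2 * g` bits, and
-- announcing `g` costs only `g` of these.
theorem IsUniversal.exists_condK_add_le_of_inTail (hU : U.IsUniversal) {r : RequestSeq}
    (hr : Computable r) :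
    ∃ d, ∀ g y i l x, (∀ n, r.kraftSum n ≤ r.kraftSum y.length + (2 ^ (2 * g + 1))⁻¹) →
      r.InTail y.length (2 * g) i → r i = some (l, x) → U.condK x y + g ≤ l + d := by
  have hstage : Computable fun a : ℕ × List Bool => a.2.length :=
    Computable.list_length.comp Computable.snd
  have hgain : Computable fun a : ℕ × List Bool => 2 * a.1 :=
    (Primrec.nat_mul.comp (Primrec.const 2) Primrec.fst).to_comp
  obtain ⟨V, hV⟩ := RequestSeq.exists_machine (RequestSeq.computable_tailRequests hr hstage hgain)
  obtain ⟨d, hd⟩ := hU.exists_condK_le_of_machine V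
  refine ⟨d + 2, fun g y i l x hN htail hi => ?_⟩
  have hshort : r.tailRequests y.length (2 * g) i = some (l - 2 * g, x) := by
    simp [RequestSeq.tailRequests, htail, hi]
  obtain ⟨p, hp, hx⟩ := hV g y i _ x hshort (RequestSeq.kraftSum_tailRequests_le_one hN _)
  have hlen := htail.le_of_eq_some hN hi
  have hcond := hd p y x hx
  omega

theorem IsUniversal.exists_finite_of_independent (hU : U.IsUniversal) (b : ℕ) :
    ∃ F : Set (List Bool), F.Finite ∧ ∀ x y, U.K x ≤ U.condK x y + b → x ∈ F ∨ y ∈ F := by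
  obtain ⟨r, hr, hsum, hprograms⟩ := U.exists_programRequests
  obtain ⟨d, hd⟩ := hU.exists_condK_add_le_of_inTail hr
  obtain ⟨J, hJ⟩ := RequestSeq.exists_kraftSum_le_add hsum
    (ε := (2 ^ (2 * (b + d + 1) + 1))⁻¹) (by positivity)
  refine ⟨{x | ∃ i < J, ∃ l, r i = some (l, x)} ∪ {y | y.length < J}, ?_, fun x y hxy => ?_⟩
  · refine Set.Finite.union ?_ (List.finite_length_lt Bool J)
    refine (((Set.finite_Iio J).image fun i => (r i).map Prod.snd).preimage
      (Option.some_injective _).injOn).subset fun x ⟨i, hi, l, hx⟩ => ⟨i, hi, ?_⟩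
    simp [hx]
  by_contra! hF
  obtain ⟨p, hp, hx⟩ := hU.exists_program x []
  obtain ⟨i, hi⟩ := hprograms p x hx
  have hiJ : J ≤ i := not_lt.1 fun hlt => hF.1 (Or.inl ⟨i, hlt, _, hi⟩)
  have hyJ : J ≤ y.length := not_lt.1 fun hlt => hF.2 (Or.inr hlt)
  have hgain := hd (b + d + 1) y i _ x
    (fun n => (hJ n).trans (by gcongr; exact r.kraftSum_mono hyJ))
    ((hJ _).trans (by gcongr; exact r.kraftSum_mono hiJ)) hi
  have hK : p.length = U.K x := hp
  omega

end PrefixMachine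

/-! ## Simulation of an adaptation device -/

/-- The configuration after the device has written the bit `v` to cell `i` of the adaptation
substrate and gone over to control state `l`. -/
def overwriteCell (q : AdaptConfig) (i l : ℕ) (v : Bool) : AdaptConfig :=
  (l, q.2.1, q.2.2.1, q.2.2.2.set i v)

/-- An erasure of cell `w.1`, leading to control state `w.2`, that writes the first bit of the
supply; it is `none` if the supply is exhausted. -/
def eraseStep (a : AdaptConfig × List Bool) (w : ℕ × ℕ) : Option (AdaptConfig × List Bool) :=
  a.2.head?.map fun v => (overwriteCell a.1 w.1 w.2 v, a.2.tail)

/-- One step of the device with a supply of bits, of which every erasure writes and consumes the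
next one. The outcome is the final execution substrate with the remaining supply, or the next
configuration with its supply; it is `none` if an erasure finds the supply exhausted. -/
def supplyStep (instr : AdaptConfig → AdaptInstr) (a : AdaptConfig × List Bool) :
    Option ((List Bool × List Bool) ⊕ (AdaptConfig × List Bool)) :=
  match instr a.1 with
  | none => some (Sum.inl (a.1.2.1, a.2))
  | some (Sum.inl q) => some (Sum.inr (q, a.2))
  | some (Sum.inr w) => (eraseStep a w).map Sum.inr

/-- The run of the device with a supply of bits, up to halting. -/
def supplyRun (instr : AdaptConfig → AdaptInstr) :
    AdaptConfig × List Bool →. List Bool × List Bool :=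
  PFun.fix fun a => (supplyStep instr a : Part _)

theorem primrec_overwriteCell :
    Primrec fun b : AdaptConfig × ℕ × ℕ × Bool => overwriteCell b.1 b.2.1 b.2.2.1 b.2.2.2 := by
  have htail : Primrec fun b : AdaptConfig × ℕ × ℕ × Bool => b.1.2 :=
    Primrec.snd.comp Primrec.fst
  have hcells : Primrec fun b : AdaptConfig × ℕ × ℕ × Bool =>
      b.1.2.2.2.set b.2.1 b.2.2.2 :=
    Primrec.list_set.comp (Primrec.snd.comp (Primrec.snd.comp htail))
      ((Primrec.fst.comp Primrec.snd).pair
        (Primrec.snd.comp (Primrec.snd.comp Primrec.snd)))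
  exact (Primrec.fst.comp (Primrec.snd.comp Primrec.snd)).pair ((Primrec.fst.comp htail).pair
    ((Primrec.fst.comp (Primrec.snd.comp htail)).pair hcells))

theorem primrec_eraseStep : Primrec₂ eraseStep := by
  have hwrite : Primrec₂ fun (b : (AdaptConfig × List Bool) × ℕ × ℕ) (v : Bool) =>
      overwriteCell b.1.1 b.2.1 b.2.2 v := by
    have h := primrec_overwriteCell.comp (((Primrec.fst.comp Primrec.fst).comp
      Primrec.fst).pair (((Primrec.fst.comp Primrec.snd).comp Primrec.fst).pair
        (((Primrec.snd.comp Primrec.snd).comp Primrec.fst).pair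
          (Primrec.snd (α := (AdaptConfig × List Bool) × ℕ × ℕ) (β := Bool)))))
    exact h
  have hsupply : Primrec fun b : (AdaptConfig × List Bool) × ℕ × ℕ => b.1.2 :=
    Primrec.snd.comp Primrec.fst
  exact Primrec.option_map (Primrec.list_head?.comp hsupply)
    (Primrec.pair hwrite (Primrec.list_tail.comp (hsupply.comp Primrec.fst)))

section SupplyRun

variable {instr : AdaptConfig → AdaptInstr}

theorem computable_supplyStep (hi : Computable instr) : Computable (supplyStep instr) := by
  have hhalt : Computable fun a : AdaptConfig × List Bool =>
      some (Sum.inl (β := AdaptConfig × List Bool) (a.1.2.1, a.2)) :=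
    (Primrec.option_some.comp (Primrec.sumInl.comp ((Primrec.fst.comp
      (Primrec.snd.comp Primrec.fst)).pair Primrec.snd))).to_comp
  have hmove : Computable₂ fun (b : (AdaptConfig × List Bool) × (AdaptConfig ⊕ ℕ × ℕ))
      (q : AdaptConfig) => some (Sum.inr (α := List Bool × List Bool) (q, b.1.2)) :=
    (Primrec.option_some.comp (Primrec.sumInr.comp (Primrec.snd.pair
      (Primrec.snd.comp (Primrec.fst.comp Primrec.fst))))).to_comp
  have herase : Computable₂ fun (b : (AdaptConfig × List Bool) × (AdaptConfig ⊕ ℕ × ℕ))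
      (w : ℕ × ℕ) => (eraseStep b.1 w).map (Sum.inr (α := List Bool × List Bool)) :=
    (Primrec.option_map (primrec_eraseStep.comp (Primrec.fst.comp Primrec.fst) Primrec.snd)
      (Primrec.sumInr.comp Primrec.snd).to₂).to_comp
  refine (Computable.option_casesOn (hi.comp Computable.fst) hhalt
    (Computable.sumCasesOn Computable.snd hmove herase).to₂).of_eq fun a => ?_
  rcases h : instr a.1 with _ | q | ⟨i, l⟩ <;> simp [supplyStep, eraseStep, h]

theorem partrec_supplyRun (hi : Computable instr) : Partrec (supplyRun instr) :=
  Partrec.fix (computable_supplyStep hi).ofOption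

theorem supplyStep_append {q : AdaptConfig} {p : List Bool}
    {c : (List Bool × List Bool) ⊕ (AdaptConfig × List Bool)}
    (h : supplyStep instr (q, p) = some c) (t : List Bool) :
    supplyStep instr (q, p ++ t) =
      some (Sum.map (Prod.map id (· ++ t)) (Prod.map id (· ++ t)) c) := by
  rcases hq : instr q with _ | q' | ⟨i, l⟩ <;> simp only [supplyStep, hq] at h ⊢
  · obtain rfl := Option.some_inj.1 h
    rfl
  · obtain rfl := Option.some_inj.1 h
    rfl
  · cases p with
    | nil => simp [eraseStep] at h
    | cons v p =>
      obtain rfl := Option.some_inj.1 h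
      rfl

theorem supplyRun_append {a : AdaptConfig × List Bool} {S p : List Bool}
    (h : (S, p) ∈ supplyRun instr a) (t : List Bool) :
    (S, p ++ t) ∈ supplyRun instr (a.1, a.2 ++ t) := by
  refine PFun.fixInduction' (C := fun a => (S, p ++ t) ∈ supplyRun instr (a.1, a.2 ++ t)) h
    (fun a ha => ?_) fun a a' _ ha ih => ?_
  · exact PFun.fix_stop (Part.mem_ofOption.2 (supplyStep_append (Part.mem_ofOption.1 ha) t))
  · exact PFun.mem_fix_iff.2
      (Or.inr ⟨_, Part.mem_ofOption.2 (supplyStep_append (Part.mem_ofOption.1 ha) t), ih⟩)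

theorem AdaptRun.exists_supply {q r : AdaptConfig} {n : ℕ} (h : AdaptRun instr q n r) :
    ∃ v : List Bool, v.length = n ∧
      ∀ p, supplyRun instr (q, v ++ p) = supplyRun instr (r, p) := by
  induction h with
  | refl => exact ⟨[], rfl, fun p => rfl⟩
  | step r s m n _ hstep ih =>
    obtain ⟨v, hv, ih⟩ := ih
    cases hstep with
    | reversible _ _ hr =>
      exact ⟨v, hv, fun p => (ih p).trans (PFun.fix_fwd_eq (by simp [supplyStep, hr]))⟩
    | erase k l i S D W bit hr hi =>
      refine ⟨v ++ [bit], by simp [hv], fun p => ?_⟩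
      rw [List.append_assoc, ih]
      exact PFun.fix_fwd_eq (by simp [supplyStep, eraseStep, overwriteCell, hr])

/-- `HaltingRun instr S₀ D S H` is `AdaptationProcess.Adapts` for arbitrary instructions, of which
neither effectiveness nor logical reversibility is required. -/
def HaltingRun (instr : AdaptConfig → AdaptInstr) (S₀ D S : List Bool) (H : ℕ) : Prop :=
  ∃ (k : ℕ) (D' W : List Bool),
    AdaptRun instr (0, S₀, D, []) H (k, S, D', W) ∧ instr (k, S, D', W) = none

theorem HaltingRun.exists_supply {S₀ D S : List Bool} {H : ℕ} (h : HaltingRun instr S₀ D S H) :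
    ∃ v : List Bool, v.length = H ∧
      ∀ p, (S, p) ∈ supplyRun instr ((0, S₀, D, []), v ++ p) := by
  obtain ⟨k, D', W, hrun, hhalt⟩ := h
  obtain ⟨v, hv, hsupply⟩ := hrun.exists_supply
  refine ⟨v, hv, fun p => ?_⟩
  rw [hsupply]
  exact PFun.fix_stop (by simp [supplyStep, hhalt])

end SupplyRun

namespace PrefixMachine

/-- The prefix machine that runs the device from the execution substrate `S₀` on the adaptation
input given as side input, taking the bits written by erasures from the program, and then runs `U`
on the rest of the program with the final execution substrate as side input. -/
def adaptMachine (U : PrefixMachine) {instr : AdaptConfig → AdaptInstr} (hi : Computable instr)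
    (S₀ : List Bool) : PrefixMachine where
  eval p D := (supplyRun instr ((0, S₀, D, []), p)).bind fun b => U.eval b.2 b.1
  partrec := by
    refine Partrec.bind ((partrec_supplyRun hi).comp ?_) ?_
    · exact (((Primrec.const 0).pair ((Primrec.const S₀).pair
        (Primrec.snd.pair (Primrec.const [])))).pair Primrec.fst).to_comp
    · exact Partrec₂.comp U.partrec (Computable.snd.comp Computable.snd)
        (Computable.fst.comp Computable.snd)
  prefix_free D p q hp hq hpq := by
    obtain ⟨t, rfl⟩ := hpq
    obtain ⟨x, hx⟩ := Part.dom_iff_mem.1 hp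
    obtain ⟨x', hx'⟩ := Part.dom_iff_mem.1 hq
    obtain ⟨⟨S, p'⟩, hS, hx⟩ := Part.mem_bind_iff.1 hx
    obtain ⟨b, hb, hx'⟩ := Part.mem_bind_iff.1 hx'
    obtain rfl := Part.mem_unique hb (supplyRun_append hS t)
    have hrest : p' = p' ++ t := U.prefix_free S _ _ (Part.dom_iff_mem.2 ⟨x, hx⟩)
      (Part.dom_iff_mem.2 ⟨x', hx'⟩) (List.prefix_append _ _)
    rw [List.self_eq_append_right.1 hrest, List.append_nil]

variable {U : PrefixMachine}

theorem IsUniversal.exists_condK_le_of_haltingRun (hU : U.IsUniversal)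
    {instr : AdaptConfig → AdaptInstr} (hi : Computable instr) (S₀ : List Bool) :
    ∃ d, ∀ D S x H, HaltingRun instr S₀ D S H → U.condK x D ≤ U.condK x S + H + d := by
  obtain ⟨d, hd⟩ := hU.exists_condK_le_of_machine (U.adaptMachine hi S₀)
  refine ⟨d, fun D S x H hrun => ?_⟩
  obtain ⟨v, hv, hsupply⟩ := hrun.exists_supply
  obtain ⟨p, hp, hx⟩ := hU.exists_program x S
  have hlen := hd (v ++ p) D x (Part.mem_bind_iff.2 ⟨(S, p), hsupply p, hx⟩)
  rw [List.length_append] at hlen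
  omega

end PrefixMachine

/-! ## Uniform constants and the energy bound -/

theorem exists_nat_forall_mem_of_finite {α : Type*} {s : Set α} (hs : s.Finite)
    {p : α → ℕ → Prop} (hmono : ∀ a, Monotone (p a)) (h : ∀ a ∈ s, ∃ n, p a n) :
    ∃ n, ∀ a ∈ s, p a n := by
  choose! f hf using h
  obtain ⟨n, hn⟩ := (hs.image f).bddAbove
  exact ⟨n, fun a ha => hmono a (hn ⟨a, ha, rfl⟩) (hf a ha)⟩

theorem computable_of_code_eval {α β : Type*} [Primcodable α] [Primcodable β] {f : α → β}
    {c : Nat.Partrec.Code}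
    (hc : ∀ a, c.eval (Encodable.encode a) = Part.some (Encodable.encode (f a))) :
    Computable f :=
  Computable.encode_iff.1 ((Nat.Partrec.Code.eval_part.comp (Computable.const c)
    Computable.encode).of_eq hc)

theorem injective_bits : Function.Injective Nat.bits := fun m n h => by
  refine Nat.digits.injective 2 ?_
  rw [Nat.digits_two_eq_bits, Nat.digits_two_eq_bits, h]

namespace PrefixMachine.IsUniversal

variable {U : PrefixMachine}

theorem finite_setOf_code_eval {α β : Type*} [Encodable α] [Encodable β] (hU : U.IsUniversal)
    (b : ℕ) :
    {f : α → β | ∃ c : Nat.Partrec.Code, U.K (Nat.bits (Encodable.encode c)) ≤ b ∧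
      ∀ a, c.eval (Encodable.encode a) = Part.some (Encodable.encode (f a))}.Finite := by
  have hcodes : {c : Nat.Partrec.Code | U.K (Nat.bits (Encodable.encode c)) ≤ b}.Finite :=
    (hU.finite_setOf_K_le b).preimage
      (injective_bits.comp Encodable.encode_injective).injOn
  refine (hcodes.biUnion (t := fun c =>
    {f : α → β | ∀ a, c.eval (Encodable.encode a) = Part.some (Encodable.encode (f a))})
    fun c _ => Set.Subsingleton.finite fun f hf g hg => funext fun a => ?_).subset
      fun f ⟨c, hc, hf⟩ => Set.mem_iUnion₂.2 ⟨c, hc, hf⟩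
  exact Encodable.encode_injective (Part.some_injective ((hf a).symm.trans (hg a)))

theorem exists_condK_le_of_independent (hU : U.IsUniversal) (b : ℕ) :
    ∃ d, ∀ (c : Nat.Partrec.Code) (instr : AdaptConfig → AdaptInstr),
      (∀ q, c.eval (Encodable.encode q) = Part.some (Encodable.encode (instr q))) →
      U.K (Nat.bits (Encodable.encode c)) ≤ b → ∀ σ S₀, U.K σ ≤ U.condK σ S₀ + b →
      ∀ D S H, HaltingRun instr S₀ D S H → U.condK σ D ≤ U.condK σ S + H + d := by
  obtain ⟨F, hF, hindep⟩ := hU.exists_finite_of_independent b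
  obtain ⟨d₁, hd₁⟩ := exists_nat_forall_mem_of_finite hF
    (p := fun x d => ∀ y, U.condK x y ≤ d) (fun _ _ _ hmn h y => (h y).trans hmn)
    fun x _ => hU.exists_condK_le x
  obtain ⟨d₂, hd₂⟩ := exists_nat_forall_mem_of_finite ((hU.finite_setOf_code_eval b).prod hF)
    (p := fun a d => ∀ D S x H, HaltingRun a.1 a.2 D S H → U.condK x D ≤ U.condK x S + H + d)
    (fun _ _ _ hmn h D S x H hrun => (h D S x H hrun).trans (by gcongr))
    fun a ⟨⟨_, _, hc⟩, _⟩ => hU.exists_condK_le_of_haltingRun (computable_of_code_eval hc) a.2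
  refine ⟨d₁ + d₂, fun c instr hc hcb σ S₀ hσ D S H hrun => ?_⟩
  rcases hindep σ S₀ hσ with hmem | hmem
  · have := hd₁ σ hmem D
    omega
  · have := hd₂ (instr, S₀) ⟨⟨c, hcb, hc⟩, hmem⟩ D S σ H hrun
    omega

end PrefixMachine.IsUniversal

theorem landauerCost_nonneg {T : ℝ} (hT : 0 ≤ T) : 0 ≤ landauerCost T := by
  rw [landauerCost, boltzmannConstant]
  positivity

theorem Substrate.EnergyFloor.mul_max_zero_le {X : Substrate} {T E x : ℝ} {N : ℕ} (hT : 0 ≤ T)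
    (hE : X.EnergyFloor T N E) (hx : x ≤ N) : X.overhead * landauerCost T * max x 0 ≤ E :=
  have hF : 0 ≤ X.overhead := zero_le_one.trans X.one_le_overhead
  calc X.overhead * landauerCost T * max x 0
      ≤ X.overhead * landauerCost T * N :=
        mul_le_mul_of_nonneg_left (max_le hx N.cast_nonneg)
          (mul_nonneg hF (landauerCost_nonneg hT))
    _ = X.overhead * N * landauerCost T := by ring
    _ ≤ E := hE

theorem theorem2_general (U : PrefixMachine) (hU : U.IsUniversal) (b : ℕ) :
    ∃ cU : ℕ, ∀ (c : Nat.Partrec.Code) (instr : AdaptConfig → AdaptInstr),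
      (∀ q, c.eval (Encodable.encode q) = Part.some (Encodable.encode (instr q))) →
      U.K (Nat.bits (Encodable.encode c)) ≤ b →
      ∀ σ S₀ : List Bool, U.K σ ≤ U.condK σ S₀ + b →
      ∀ (D S : List Bool) (Herase : ℕ), HaltingRun instr S₀ D S Herase →
      ∀ (Hadapt : Substrate) (T Eadapt : ℝ), 0 < T → Hadapt.EnergyFloor T Herase Eadapt →
        Eadapt ≥ Hadapt.overhead * landauerCost T *
          max (U.mutualInfo S σ - U.mutualInfo D σ - (cU : ℝ)) 0 := by
  obtain ⟨d, hd⟩ := hU.exists_condK_le_of_independent b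
  refine ⟨d, fun c instr hc hcb σ S₀ hσ D S H hrun X T E hT hE => ?_⟩
  refine hE.mul_max_zero_le hT.le ?_
  have hcond : (U.condK σ D : ℝ) ≤ U.condK σ S + H + d := by
    exact_mod_cast hd c instr hc hcb σ S₀ hσ D S H hrun
  rw [PrefixMachine.mutualInfo, PrefixMachine.mutualInfo]
  linarith

theorem theorem2 (U : PrefixMachine) (hU : U.IsUniversal) (b : ℕ) :
    ∃ cU : ℕ,
      -- adaptation processes of constant-size description
      ∀ P : AdaptationProcess, U.K P.description ≤ b →
      -- the class descriptor, and an initial substrate state carrying no information about it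
      ∀ σ S₀ : List Bool, U.K σ ≤ U.condK σ S₀ + b →
      -- adaptation input, post-adaptation substrate state, number of logical erasures
      ∀ (D S : List Bool) (Herase : ℕ), P.Adapts S₀ D S Herase →
      -- adaptation substrate, ambient temperature, adaptation energy
      ∀ (Hadapt : Substrate) (T Eadapt : ℝ), 0 < T → Hadapt.EnergyFloor T Herase Eadapt →
        Eadapt ≥ Hadapt.overhead * landauerCost T *
          max (U.mutualInfo S σ - U.mutualInfo D σ - (cU : ℝ)) 0 := by
  obtain ⟨cU, hcU⟩ := theorem2_general U hU b
  exact ⟨cU, fun P => hcU P.code P.instr P.computes⟩
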